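/- Let $d\ge 1$. For a function $g$ on $\mathbb{R}\times\mathbb{R}^d$ write $$\rho^*g(x,v)=\int_{\mathbb{R}} g(t,x+tv)\,\mathrm{d}t,\qquad (x,v)\in\mathbb{R}^d\times\mathbb{R}^d .$$ (i) Let $\sigma>1$ and let $q(\sigma)$ be given by $\frac{1}{q(\sigma)}+\frac{d}{(d+1)\sigma}=1$. There is a finite constant $C$, depending only on $d$ and $\sigma$, such that for every $g\in L^{q(\sigma)}_tL^{(d+1)\sigma/2}_x(\mathbb{R}\times\mathbb{R}^d)$ the integral defining $\rho^*g(x,v)$ converges absolutely for almost every $(x,v)$, the function $\rho^*g$ belongs to $L^{\sigma(d+1)}_{x,v}(\mathbb{R}^d\times\mathbb{R}^d)$, and $$\|\rho^*g\|_{L^{\sigma(d+1)}_{x,v}}\le C\,\|g\|_{L^{q(\sigma)}_tL^{(d+1)\sigma/2}_x}.$$ (ii) (All non-endpoint Strichartz estimates for the kinetic transport equation.) Let $q,p,r,a\in(0,\infty]$ satisfy, with $1/\infty=0$, $$\frac{2}{q}=d\Big(\frac1r-\frac1p\Big),\qquad \frac1a=\frac12\Big(\frac1r+\frac1p\Big),\qquad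 q>a,\qquad p\ge a .$$ There is a finite constant $C$, depending only on $(q,p,r,a,d)$, such that for every $f^0\in L^a_{x,v}(\mathbb{R}^d\times\mathbb{R}^d)$ the solution $f(t,x,v)=f^0(x-tv,v)$ of $\partial_tf+v\cdot\nabla_xf=0$, $f(0,x,v)=f^0(x,v)$, satisfies $$\|f\|_{L^q_tL^p_xL^r_v}\le C\,\|f^0\|_{L^a_{x,v}} .$$ -/

import Mathlib

open MeasureTheory
open scoped ENNReal NNReal

/-- Euclidean space of dimension `d`, in which both the position `x` and the velocity `v` live. -/
abbrev Pos (d : ℕ) : Type := EuclideanSpace ℝ (Fin d)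

/-- The operator `ρ* g (x, v) = ∫ g (t, x + t v) dt`. -/
noncomputable def rhoStar {d : ℕ} (g : ℝ × Pos d → ℂ) (z : Pos d × Pos d) : ℂ :=
  ∫ t : ℝ, g (t, z.1 + t • z.2)

/-- The mixed norm of `g` in `L^q_t L^p_x`, with values in `[0, ∞]`. -/
noncomputable def normTX {d : ℕ} (q p : ℝ≥0∞) (g : ℝ × Pos d → ℂ) : ℝ≥0∞ :=
  eLpNorm (fun t : ℝ => eLpNorm (fun x : Pos d => g (t, x)) p volume) q volume

/-- Membership in `L^q_t L^p_x`. -/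
def MemTX {d : ℕ} (q p : ℝ≥0∞) (g : ℝ × Pos d → ℂ) : Prop :=
  AEStronglyMeasurable g volume ∧ normTX q p g < ∞

/-- The mixed norm of `f` in `L^q_t L^p_x L^r_v`, with values in `[0, ∞]`. -/
noncomputable def normTXV {d : ℕ} (q p r : ℝ≥0∞) (f : ℝ → Pos d → Pos d → ℂ) : ℝ≥0∞ :=
  eLpNorm (fun t : ℝ => eLpNorm (fun x : Pos d =>
    eLpNorm (fun v : Pos d => f t x v) r volume) p volume) q volume

/-- The solution `f (t, x, v) = f⁰ (x - t v, v)` of the kinetic transport equation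
`∂_t f + v · ∇_x f = 0`, `f (0, x, v) = f⁰ (x, v)`. -/
def transportSolution {d : ℕ} (f₀ : Pos d × Pos d → ℂ) (t : ℝ) (x v : Pos d) : ℂ :=
  f₀ (x - t • v, v)

/-- The non-endpoint exponents for the Strichartz estimates: `q, p, r, a` in `(0, ∞]` with
`2/q = d (1/r - 1/p)`, `1/a = (1/r + 1/p)/2`, `q > a` and `p ≥ a`. Here `1/∞ = 0`, and the
identities are between real numbers. -/
structure NonEndpoint (d : ℕ) (q p r a : ℝ≥0∞) : Prop where
  q_pos : 0 < q
  p_pos : 0 < p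
  r_pos : 0 < r
  a_pos : 0 < a
  scaling : 2 * (q⁻¹).toReal = d * ((r⁻¹).toReal - (p⁻¹).toReal)
  mean : (a⁻¹).toReal = ((r⁻¹).toReal + (p⁻¹).toReal) / 2
  a_lt_q : a < q
  a_le_p : a ≤ p

/-! Everything is reduced to nonnegative functions and to the case `a = 2`, `r = p'`. There the
Strichartz estimate is dual to an `L²` bound for the averages of `g(t, x + tv, v)` over `t`, and the
`T T*` method applies: the square of the average is a double integral in `t` and `s`, each slice of
which obeys the dispersive bound with kernel `|t - s|^{-d(1 - 2/p)}`
(`lintegral_shear_mul_shear_le`). By scaling this exponent is `2/q`, and `q > 2` makes it less than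
`1`, so the one-dimensional Hardy–Littlewood–Sobolev inequality
(`lintegral_lintegral_mul_mul_rpow_neg_le`) sums the slices.

Duality then gives the transport estimate at `a = 2`. Since transport commutes with powers, applying
it to `f^{a/2}` gives every `a` with `a < p` and `a < q` (`mixedLintegral_transport_le`). The
remaining case `p = a` is conservation of the `L^a` norm.

For the first claim, `ρ*` is the adjoint of the velocity average `φ ↦ ∫ φ(x - tv, v) dv`, which the
transport estimate with `r = 1` bounds; `σ > 1` is precisely the non-endpoint condition there. -/

/-! ### Hardy–Littlewood–Sobolev on the line. -/

theorem lintegral_comp_abs (f : ℝ → ℝ≥0∞) :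
    ∫⁻ u : ℝ, f |u| = 2 * ∫⁻ u in Set.Ioi (0 : ℝ), f u := by
  rw [← lintegral_add_compl _ (measurableSet_Ioi (a := (0 : ℝ))), two_mul]
  congr 1
  · exact setLIntegral_congr_fun measurableSet_Ioi fun u hu => by rw [abs_of_pos hu]
  · rw [Set.compl_Ioi, ← restrict_Iio_eq_restrict_Iic]
    have h := (Measure.measurePreserving_neg (volume : Measure ℝ)).setLIntegral_comp_preimage_emb
      (MeasurableEquiv.neg ℝ).measurableEmbedding f (Set.Ioi 0)
    rw [← h]
    have : (Neg.neg ⁻¹' Set.Ioi (0 : ℝ)) = Set.Iio 0 := by ext; simp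
    rw [this]
    exact setLIntegral_congr_fun measurableSet_Iio fun u hu => by rw [abs_of_neg hu]

theorem lintegral_ball_rpow_neg {l : ℝ} (hl : l < 1) {R : ℝ} (hR : 0 < R) :
    ∫⁻ u : ℝ, (Set.Iio R).indicator (fun x => ENNReal.ofReal x ^ (-l)) |u| =
      ENNReal.ofReal (2 / (1 - l) * R ^ (1 - l)) := by
  rw [lintegral_comp_abs, lintegral_indicator measurableSet_Iio,
    Measure.restrict_restrict measurableSet_Iio, Set.Iio_inter_Ioi]
  have h1 : ∫⁻ u in Set.Ioo 0 R, ENNReal.ofReal u ^ (-l) =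
      ∫⁻ u in Set.Ioo 0 R, ENNReal.ofReal (u ^ (-l)) :=
    setLIntegral_congr_fun measurableSet_Ioo fun u hu => by
      rw [ENNReal.ofReal_rpow_of_pos hu.1]
  have hint : IntegrableOn (fun u : ℝ => u ^ (-l)) (Set.Ioo 0 R) := by
    rw [intervalIntegral.integrableOn_Ioo_rpow_iff hR]; linarith
  rw [h1, ← ofReal_integral_eq_lintegral_ofReal hint, ← integral_Ioc_eq_integral_Ioo,
    ← intervalIntegral.integral_of_le hR.le, integral_rpow (Or.inl (by linarith)),
    Real.zero_rpow (by linarith), ← ENNReal.ofReal_ofNat, ← ENNReal.ofReal_mul (by norm_num)]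
  · congr 1
    rw [show -l + 1 = 1 - l by ring]; ring
  · filter_upwards [ae_restrict_mem measurableSet_Ioo] with u hu
    exact Real.rpow_nonneg hu.1.le _

theorem lintegral_compl_ball_rpow_neg_two {R : ℝ} (hR : 0 < R) :
    ∫⁻ u : ℝ, (Set.Ici R).indicator (fun x => ENNReal.ofReal x ^ (-2 : ℝ)) |u| =
      ENNReal.ofReal (2 / R) := by
  rw [lintegral_comp_abs, lintegral_indicator measurableSet_Ici,
    Measure.restrict_restrict measurableSet_Ici,
    Set.inter_eq_left.2 (Set.Ici_subset_Ioi.2 hR), ← restrict_Ioi_eq_restrict_Ici]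
  have h1 : ∫⁻ u in Set.Ioi R, ENNReal.ofReal u ^ (-2 : ℝ) =
      ∫⁻ u in Set.Ioi R, ENNReal.ofReal (u ^ (-2 : ℝ)) :=
    setLIntegral_congr_fun measurableSet_Ioi fun u hu => by
      rw [ENNReal.ofReal_rpow_of_pos (hR.trans hu)]
  rw [h1, ← ofReal_integral_eq_lintegral_ofReal (integrableOn_Ioi_rpow_of_lt (by norm_num) hR),
    integral_Ioi_rpow_of_lt (by norm_num) hR,
    ← ENNReal.ofReal_ofNat, ← ENNReal.ofReal_mul (by norm_num)]
  · congr 1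
    rw [show (-2 : ℝ) + 1 = -1 by norm_num, Real.rpow_neg_one]; ring
  · filter_upwards [ae_restrict_mem measurableSet_Ioi] with u hu
    exact Real.rpow_nonneg (hR.trans hu).le _

/-- Hedberg-type bound for a potential of `N`, in which `N` is cut off at the height `n`. -/
theorem lintegral_min_mul_rpow_neg_le {l : ℝ} (hl0 : 0 < l) (hl1 : l < 1) {N : ℝ → ℝ≥0∞}
    (hN : Measurable N) (n : ℝ≥0∞) (s : ℝ) {R : ℝ} (hR : 0 < R) :
    ∫⁻ t, min (N t) n * ENNReal.ofReal |t - s| ^ (-l) ≤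
      n * ENNReal.ofReal (2 / (1 - l) * R ^ (1 - l)) +
        (∫⁻ t, N t ^ (2 / (2 - l))) ^ (1 - l / 2) * ENNReal.ofReal (2 / R) ^ (l / 2) := by
  have hq : (2 / (2 - l)).HolderConjugate (2 / l) := by
    rw [Real.holderConjugate_iff]
    constructor
    · rw [lt_div_iff₀] <;> linarith
    · field_simp; ring
  have hk : Measurable fun u : ℝ => ENNReal.ofReal |u| ^ (-l) := by fun_prop
  have hk' : Measurable fun x : ℝ => ENNReal.ofReal x ^ (-l) := by fun_prop
  set F : ℝ → ℝ≥0∞ := fun u => (Set.Iio R).indicator (fun x => ENNReal.ofReal x ^ (-l)) |u|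
  set G : ℝ → ℝ≥0∞ := fun u => (Set.Ici R).indicator (fun x => ENNReal.ofReal x ^ (-l)) |u|
  have hF : Measurable F := (hk'.indicator measurableSet_Iio).comp measurable_norm
  have hG : Measurable G := (hk'.indicator measurableSet_Ici).comp measurable_norm
  have hFG : ∀ u, ENNReal.ofReal |u| ^ (-l) = F u + G u := by
    intro u
    by_cases h : |u| < R
    · simp [F, G, h]
    · simp [F, G, h, not_lt.1 h]
  calc ∫⁻ t, min (N t) n * ENNReal.ofReal |t - s| ^ (-l)
      ≤ ∫⁻ t, (n * F (t - s) + N t * G (t - s)) := by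
        refine lintegral_mono fun t => ?_
        rw [hFG, mul_add]
        gcongr
        · exact min_le_right _ _
        · exact min_le_left _ _
    _ = n * (∫⁻ t, F (t - s)) + ∫⁻ t, N t * G (t - s) := by
        rw [lintegral_add_left (by fun_prop), lintegral_const_mul _ (by fun_prop)]
    _ ≤ _ := by
        gcongr
        · rw [lintegral_sub_right_eq_self F s, lintegral_ball_rpow_neg hl1 hR]
        · refine (ENNReal.lintegral_mul_le_Lp_mul_Lq volume hq hN.aemeasurable
            (g := fun t => G (t - s)) (by fun_prop)).trans ?_
          rw [show 1 / (2 / (2 - l)) = 1 - l / 2 by field_simp,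
            show 1 / (2 / l) = l / 2 by field_simp]
          gcongr
          rw [lintegral_sub_right_eq_self (fun u => G u ^ (2 / l)) s,
            ← lintegral_compl_ball_rpow_neg_two hR]
          refine lintegral_mono fun u => ?_
          by_cases h : R ≤ |u|
          · simp only [G, Set.indicator, Set.mem_Ici, h, if_true]
            rw [← ENNReal.rpow_mul, show -l * (2 / l) = -2 by field_simp]
          · simp [G, h, hl0]

/-- The diagonal Hardy–Littlewood–Sobolev inequality on the line. -/
theorem lintegral_lintegral_mul_mul_rpow_neg_le {l : ℝ} (hl0 : 0 < l) (hl1 : l < 1) :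
    ∃ C : ℝ≥0, C ≠ 0 ∧ ∀ N : ℝ → ℝ≥0∞, Measurable N →
      ∫⁻ t, ∫⁻ s, N t * N s * ENNReal.ofReal |t - s| ^ (-l) ≤
        C * (∫⁻ t, N t ^ (2 / (2 - l))) ^ (2 - l) := by
  set m := 2 / (2 - l) with hm
  have h2l : 0 < 2 - l := by linarith
  have hm0 : 0 < m := by positivity
  have hml : m * l / 2 = m - 1 := by rw [hm]; field_simp; ring
  have hm2l : m * (2 - l) = 2 := by rw [hm]; field_simp
  refine ⟨2 * (Real.toNNReal (2 / (1 - l)) + 2 ^ (l / 2)), by positivity, fun N hN => ?_⟩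
  set A := ∫⁻ t, N t ^ m with hA
  rcases eq_or_ne A 0 with hA0 | hA0
  · have hN0 : ∀ᵐ t, N t = 0 := by
      have := (lintegral_eq_zero_iff (by fun_prop)).1 hA0
      filter_upwards [this] with t ht
      simpa [hm0, hm0.not_gt] using ht
    have : ∫⁻ t, ∫⁻ s, N t * N s * ENNReal.ofReal |t - s| ^ (-l) = ∫⁻ t : ℝ, 0 := by
      refine lintegral_congr_ae ?_
      filter_upwards [hN0] with t ht
      simp [ht]
    rw [this]; simp
  rcases eq_or_ne A ∞ with hAt | hAt
  · rw [hAt, ENNReal.top_rpow_of_pos h2l, ENNReal.mul_top]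
    · exact le_top
    · simp only [ne_eq, ENNReal.coe_eq_zero]; positivity
  have hNt : ∀ᵐ t, N t ≠ ∞ := by
    filter_upwards [ae_lt_top (by fun_prop) hAt] with t ht h
    simp [h, hm0] at ht
  -- the potential truncated at the height of its centre
  have key : ∀ s, N s ≠ ∞ → N s * ∫⁻ t, min (N t) (N s) * ENNReal.ofReal |t - s| ^ (-l) ≤
      (Real.toNNReal (2 / (1 - l)) + 2 ^ (l / 2) : ℝ≥0) * (A ^ (1 - l) * N s ^ m) := by
    intro s hs
    rcases eq_or_ne (N s) 0 with h0 | h0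
    · simp [h0]
    lift A to ℝ≥0 using hAt with B hB
    lift N s to ℝ≥0 using hs with n hn
    have hB0 : 0 < B := by
      rw [pos_iff_ne_zero]; exact_mod_cast hA0
    have hn0 : 0 < n := by
      rw [pos_iff_ne_zero]; exact_mod_cast h0
    -- This radius balances the near part `n R^(1-l)` against the far part `B^(1-l/2) R^(-l/2)`.
    have hR : 0 < B / n ^ m := by positivity
    refine (mul_le_mul_right (lintegral_min_mul_rpow_neg_le hl0 hl1 hN n s
      (R := (B / n ^ m : ℝ≥0)) (by exact_mod_cast hR)) _).trans ?_
    rw [← hA, ENNReal.ofReal_mul (by have : 0 < 1 - l := by linarith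
                                     positivity), ← NNReal.coe_rpow, ENNReal.ofReal_coe_nnreal,
      show (2 : ℝ) / ((B / n ^ m : ℝ≥0) : ℝ) = ((2 / (B / n ^ m) : ℝ≥0) : ℝ) by push_cast; rfl,
      ENNReal.ofReal_coe_nnreal, ENNReal.ofReal,
      ← ENNReal.coe_rpow_of_nonneg _ (by linarith : 0 ≤ 1 - l / 2),
      ← ENNReal.coe_rpow_of_nonneg _ (by linarith : 0 ≤ l / 2),
      ← ENNReal.coe_rpow_of_nonneg _ (by linarith : 0 ≤ 1 - l),
      ← ENNReal.coe_rpow_of_nonneg _ hm0.le]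
    norm_cast
    apply le_of_eq
    have e1 : n * n * (B / n ^ m) ^ (1 - l) = B ^ (1 - l) * n ^ m := by
      rw [NNReal.div_rpow, ← NNReal.rpow_mul, div_eq_mul_inv, ← NNReal.rpow_neg]
      have : n ^ m = n * n * n ^ (-(m * (1 - l))) := by
        conv_rhs => rw [← NNReal.rpow_one n, ← NNReal.rpow_mul, ← NNReal.rpow_add hn0.ne',
          ← NNReal.rpow_add hn0.ne']
        congr 1
        linarith
      rw [this]; ring
    have e2 : n * (B ^ (1 - l / 2) * (2 / (B / n ^ m)) ^ (l / 2)) =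
        2 ^ (l / 2) * (B ^ (1 - l) * n ^ m) := by
      rw [NNReal.div_rpow, NNReal.div_rpow, ← NNReal.rpow_mul,
        show 1 - l = (1 - l / 2) - l / 2 by ring, NNReal.rpow_sub hB0.ne' (1 - l / 2)]
      have : n ^ m = n * n ^ (m * (l / 2)) := by
        conv_rhs => rw [← NNReal.rpow_one n, ← NNReal.rpow_mul, ← NNReal.rpow_add hn0.ne']
        congr 1
        linarith
      rw [this]
      have hY : 0 < B ^ (l / 2) := by positivity
      generalize B ^ (1 - l / 2) = X
      generalize B ^ (l / 2) = Y at hY ⊢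
      field_simp
    rw [mul_add, e2, add_mul, ← e1]
    ring
  have hmeas : Measurable (Function.uncurry fun t s : ℝ =>
      N s * (min (N t) (N s) * ENNReal.ofReal |t - s| ^ (-l))) := by fun_prop
  have hmeas' : Measurable (Function.uncurry fun t s : ℝ =>
      N t * (min (N s) (N t) * ENNReal.ofReal |s - t| ^ (-l))) := by fun_prop
  have hsym : ∫⁻ t, ∫⁻ s, N s * (min (N t) (N s) * ENNReal.ofReal |t - s| ^ (-l)) ≤
      (Real.toNNReal (2 / (1 - l)) + 2 ^ (l / 2) : ℝ≥0) * A ^ (2 - l) := by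
    rw [lintegral_lintegral_swap hmeas.aemeasurable]
    calc _ ≤ ∫⁻ s, (Real.toNNReal (2 / (1 - l)) + 2 ^ (l / 2) : ℝ≥0) *
          (A ^ (1 - l) * N s ^ m) := by
          refine lintegral_mono_ae ?_
          filter_upwards [hNt] with s hs
          rw [lintegral_const_mul _ (by fun_prop)]
          exact key s hs
      _ = _ := by
          rw [lintegral_const_mul _ (by fun_prop), lintegral_const_mul _ (by fun_prop), ← hA,
            show 2 - l = (1 - l) + 1 by ring, ENNReal.rpow_add _ _ hA0 hAt, ENNReal.rpow_one]
  have hsym' : ∫⁻ t, ∫⁻ s, N t * (min (N s) (N t) * ENNReal.ofReal |s - t| ^ (-l)) ≤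
      (Real.toNNReal (2 / (1 - l)) + 2 ^ (l / 2) : ℝ≥0) * A ^ (2 - l) := by
    rwa [lintegral_lintegral_swap hmeas'.aemeasurable]
  -- The smaller of the two values can always be taken as the truncated one. The height of the
  -- cutoff then bounds the near part of the potential, so no maximal function is needed.
  calc _ ≤ ∫⁻ t, ∫⁻ s, (N s * (min (N t) (N s) * ENNReal.ofReal |t - s| ^ (-l)) +
        N t * (min (N s) (N t) * ENNReal.ofReal |s - t| ^ (-l))) := by
        refine lintegral_mono fun t => lintegral_mono fun s => ?_
        rw [abs_sub_comm s t]
        rcases le_total (N t) (N s) with h | h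
        · rw [min_eq_left h]
          exact le_add_right (by rw [mul_comm (N t), mul_assoc])
        · rw [min_eq_left h]
          exact le_add_left (by rw [mul_assoc])
    _ = (∫⁻ t, ∫⁻ s, N s * (min (N t) (N s) * ENNReal.ofReal |t - s| ^ (-l))) +
        ∫⁻ t, ∫⁻ s, N t * (min (N s) (N t) * ENNReal.ofReal |s - t| ^ (-l)) := by
        rw [← lintegral_add_left hmeas.lintegral_prod_right]
        refine lintegral_congr fun t => ?_
        rw [← lintegral_add_left (by fun_prop)]
    _ ≤ _ := by
        refine (add_le_add hsym hsym').trans (le_of_eq ?_)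
        push_cast
        ring

/-! ### Dispersion for free transport. -/

theorem measurePreserving_shear {d : ℕ} (t : ℝ) :
    MeasurePreserving (fun z : Pos d × Pos d => (z.1 + t • z.2, z.2)) volume volume := by
  have h : MeasurePreserving (fun z : Pos d × Pos d => (z.1, z.2 + t • z.1))
      (volume.prod volume) (volume.prod volume) :=
    MeasurePreserving.skew_product (g := fun a b => b + t • a) (MeasurePreserving.id volume)
      (by fun_prop) (Filter.Eventually.of_forall fun a => map_add_right_eq_self volume (t • a))
  exact (Measure.measurePreserving_swap.comp h).comp Measure.measurePreserving_swap

/-- The source of all the decay in time: at fixed `x`, the map from velocity to position has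
Jacobian `|τ|^d`. -/
theorem lintegral_comp_add_smul {d : ℕ} {φ : Pos d → ℝ≥0∞} (hφ : Measurable φ) (x : Pos d) {τ : ℝ}
    (hτ : τ ≠ 0) :
    ∫⁻ v, φ (x + τ • v) = ENNReal.ofReal |τ| ^ (-(d : ℝ)) * ∫⁻ v, φ v := by
  have h1 : ∫⁻ v, φ (x + τ • v) = ∫⁻ w, φ (x + w) ∂(Measure.map (τ • ·) volume) := by
    rw [lintegral_map (by fun_prop) (by fun_prop)]
  rw [h1, Measure.map_addHaar_smul volume hτ, lintegral_smul_measure, lintegral_add_left_eq_self,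
    smul_eq_mul, finrank_euclideanSpace_fin, ENNReal.ofReal_rpow_of_pos (abs_pos.2 hτ),
    Real.rpow_neg (abs_nonneg _), Real.rpow_natCast, abs_inv, abs_pow]

/-- `∫ ‖F(x, ·)‖_p^{p'} dx`, the `p'`-th power of the norm of `F` in `L^{p'}_x L^p_v`, where
`p' = p / (p - 1)`. -/
noncomputable def mixedMass {d : ℕ} (p : ℝ) (F : Pos d × Pos d → ℝ≥0∞) : ℝ≥0∞ :=
  ∫⁻ x, (∫⁻ v, F (x, v) ^ p) ^ (1 / (p - 1))

/-- Splits `F` for Hölder's inequality into a power of a phase-space density of integral at most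
`mixedMass p F` and a power of a density in `x` alone of integral `mixedMass p F`. The powers of the
inner integral cancel wherever it is nonzero; where it vanishes, so does `F` for almost every `v`.
-/
theorem ae_le_mul_of_mixedMass_ne_top {d : ℕ} {p : ℝ} (hp : 2 < p) {F : Pos d × Pos d → ℝ≥0∞}
    (hF : Measurable F) (hN : mixedMass p F ≠ ∞) :
    ∀ᵐ z : Pos d × Pos d, F z ≤
      (F z ^ p * (∫⁻ v, F (z.1, v) ^ p) ^ (1 / (p - 1) - 1)) ^ (1 / p) *
        ((∫⁻ v, F (z.1, v) ^ p) ^ (1 / (p - 1))) ^ (1 - 2 / p) := by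
  have hp1 : 0 < p - 1 := by linarith
  have hp0 : 0 < p := by linarith
  have ha : Measurable fun x => ∫⁻ v, F (x, v) ^ p := by fun_prop
  have ha' : Measurable fun z : Pos d × Pos d => ∫⁻ v, F (z.1, v) ^ p := ha.comp measurable_fst
  refine (Measure.ae_prod_iff_ae_ae (μ := volume) (ν := volume)
    (measurableSet_le hF (by fun_prop))).2 ?_
  have hfin : ∀ᵐ x, (∫⁻ v, F (x, v) ^ p) ^ (1 / (p - 1)) < ∞ := ae_lt_top (by fun_prop) hN
  filter_upwards [hfin] with x hx
  have hx' : (∫⁻ v, F (x, v) ^ p) ≠ ∞ := by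
    intro h
    have : 0 < 1 / (p - 1) := by positivity
    simp [h, hp1] at hx
  rcases eq_or_ne (∫⁻ v, F (x, v) ^ p) 0 with h0 | h0
  · filter_upwards [(lintegral_eq_zero_iff (by fun_prop)).1 h0] with v hv
    have : F (x, v) = 0 := by simpa [hp0, hp0.not_gt] using hv
    simp [this]
  · refine Filter.Eventually.of_forall fun v => le_of_eq ?_
    rw [ENNReal.mul_rpow_of_nonneg _ _ (by positivity), ← ENNReal.rpow_mul, ← ENNReal.rpow_mul,
      ← ENNReal.rpow_mul, mul_assoc, ← ENNReal.rpow_add _ _ h0 hx',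
      show p * (1 / p) = 1 by field_simp,
      show (1 / (p - 1) - 1) * (1 / p) + 1 / (p - 1) * (1 - 2 / p) = 0 by field_simp; ring]
    simp

theorem lintegral_mul_rpow_le_mixedMass {d : ℕ} {p : ℝ} {F : Pos d × Pos d → ℝ≥0∞}
    (hF : Measurable F) :
    ∫⁻ z : Pos d × Pos d, F z ^ p * (∫⁻ v, F (z.1, v) ^ p) ^ (1 / (p - 1) - 1) ≤
      mixedMass p F := by
  have ha : Measurable fun x => ∫⁻ v, F (x, v) ^ p := by fun_prop
  have ha' : Measurable fun z : Pos d × Pos d => ∫⁻ v, F (z.1, v) ^ p := ha.comp measurable_fst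
  rw [Measure.volume_eq_prod, lintegral_prod _ (by fun_prop)]
  refine lintegral_mono fun x => ?_
  simp only
  rw [lintegral_mul_const _ (by fun_prop)]
  set a := ∫⁻ v, F (x, v) ^ p
  rcases eq_or_ne a 0 with h0 | h0
  · simp [h0]
  -- For a negative exponent `∞ * ∞ ^ s = ∞ * 0 = 0`, so only an inequality is available here.
  rcases eq_or_ne a ∞ with ht | ht
  · rcases lt_trichotomy (1 / (p - 1) - 1) 0 with h | h | h
    · rw [ht, ENNReal.top_rpow_of_neg h, mul_zero]; exact zero_le
    · rw [h, show 1 / (p - 1) = 1 by linarith]; simp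
    · have : 0 < 1 / (p - 1) := by linarith
      rw [ht, ENNReal.top_rpow_of_pos this]; exact le_top
  · rw [ENNReal.rpow_sub _ _ h0 ht, ENNReal.rpow_one, ENNReal.mul_div_cancel h0 ht]

theorem ae_eq_zero_of_mixedMass_eq_zero {d : ℕ} {p : ℝ} (hp : 1 < p) {F : Pos d × Pos d → ℝ≥0∞}
    (hF : Measurable F) (hN : mixedMass p F = 0) : ∀ᵐ z : Pos d × Pos d, F z = 0 := by
  have hp1 : 0 < p - 1 := by linarith
  have hp0 : 0 < p := by linarith
  refine (Measure.ae_prod_iff_ae_ae (μ := volume) (ν := volume)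
    (hF (measurableSet_singleton 0))).2 ?_
  filter_upwards [(lintegral_eq_zero_iff (by fun_prop)).1 hN] with x hx
  have h0 : ∫⁻ v, F (x, v) ^ p = 0 := by simpa [hp1, hp1.not_gt] using hx
  filter_upwards [(lintegral_eq_zero_iff (by fun_prop)).1 h0] with v hv
  simpa [hp0, hp0.not_gt] using hv

/-- The dispersive estimate for kinetic transport, in bilinear form. -/
theorem lintegral_shear_mul_shear_le {d : ℕ} (hd : 1 ≤ d) {p : ℝ} (hp : 2 < p)
    {F G : Pos d × Pos d → ℝ≥0∞} (hF : Measurable F) (hG : Measurable G) (t s : ℝ) :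
    ∫⁻ z : Pos d × Pos d, F (z.1 + t • z.2, z.2) * G (z.1 + s • z.2, z.2) ≤
      mixedMass p F ^ (1 - 1 / p) * mixedMass p G ^ (1 - 1 / p) *
        ENNReal.ofReal |t - s| ^ (-(d * (1 - 2 / p))) := by
  have hp0 : 0 < p := by linarith
  have h1p : 0 < 1 - 1 / p := by
    rw [sub_pos, div_lt_one hp0]; linarith
  have h2p : 0 < 1 - 2 / p := by
    rw [sub_pos, div_lt_one hp0]; linarith
  have hd0 : (0 : ℝ) < d := by exact_mod_cast hd
  have hexp : 0 < d * (1 - 2 / p) := by positivity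
  have hker : ENNReal.ofReal |t - s| ^ (-(d * (1 - 2 / p))) ≠ 0 := by
    rw [ENNReal.rpow_neg]; simp [hexp.le]
  rcases eq_or_ne (mixedMass p F) 0 with hF0 | hF0
  · have h := (measurePreserving_shear t).quasiMeasurePreserving.ae
      (ae_eq_zero_of_mixedMass_eq_zero (by linarith) hF hF0)
    rw [lintegral_congr_ae (g := fun _ => 0) (by filter_upwards [h] with z hz; simp [hz])]
    simp
  rcases eq_or_ne (mixedMass p G) 0 with hG0 | hG0
  · have h := (measurePreserving_shear s).quasiMeasurePreserving.ae
      (ae_eq_zero_of_mixedMass_eq_zero (by linarith) hG hG0)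
    rw [lintegral_congr_ae (g := fun _ => 0) (by filter_upwards [h] with z hz; simp [hz])]
    simp
  have hpow : ∀ {A : ℝ≥0∞}, A ≠ 0 → A ^ (1 - 1 / p) ≠ 0 := fun h h0 =>
    h ((ENNReal.rpow_eq_zero_iff_of_pos h1p).1 h0)
  rcases eq_or_ne (mixedMass p F) ∞ with hFt | hFt
  · rw [hFt, ENNReal.top_rpow_of_pos h1p, ENNReal.top_mul (hpow hG0), ENNReal.top_mul hker]
    exact le_top
  rcases eq_or_ne (mixedMass p G) ∞ with hGt | hGt
  · rw [hGt, ENNReal.top_rpow_of_pos h1p, ENNReal.mul_top (hpow hF0), ENNReal.top_mul hker]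
    exact le_top
  -- On the diagonal the kernel is `0` to a negative power, that is `∞`, and the bound is trivial
  -- because both masses are nonzero.
  rcases eq_or_ne t s with hts | hts
  · have : ENNReal.ofReal |t - s| ^ (-(d * (1 - 2 / p))) = ∞ := by
      rw [hts, sub_self, abs_zero, ENNReal.ofReal_zero, ENNReal.zero_rpow_of_neg (by linarith)]
    rw [this, ENNReal.mul_top (mul_ne_zero (hpow hF0) (hpow hG0))]
    exact le_top
  have hτ : t - s ≠ 0 := sub_ne_zero.2 hts
  set a : Pos d → ℝ≥0∞ := fun x => ∫⁻ v, F (x, v) ^ p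
  set b : Pos d → ℝ≥0∞ := fun x => ∫⁻ v, G (x, v) ^ p
  have ha : Measurable a := by fun_prop
  have hb : Measurable b := by fun_prop
  set F' : Pos d × Pos d → ℝ≥0∞ := fun z => F z ^ p * a z.1 ^ (1 / (p - 1) - 1)
  set G' : Pos d × Pos d → ℝ≥0∞ := fun z => G z ^ p * b z.1 ^ (1 / (p - 1) - 1)
  have hF' : Measurable F' := by fun_prop
  have hG' : Measurable G' := by fun_prop
  set α : Pos d → ℝ≥0∞ := fun x => a x ^ (1 / (p - 1))
  set β : Pos d → ℝ≥0∞ := fun x => b x ^ (1 / (p - 1))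
  have hα : Measurable α := by fun_prop
  have hβ : Measurable β := by fun_prop
  have eF := (measurePreserving_shear t).quasiMeasurePreserving.ae
    (ae_le_mul_of_mixedMass_ne_top hp hF hFt)
  have eG := (measurePreserving_shear s).quasiMeasurePreserving.ae
    (ae_le_mul_of_mixedMass_ne_top hp hG hGt)
  have iF : ∫⁻ z : Pos d × Pos d, F' (z.1 + t • z.2, z.2) ≤ mixedMass p F := by
    rw [(measurePreserving_shear t).lintegral_comp hF']
    exact lintegral_mul_rpow_le_mixedMass hF
  have iG : ∫⁻ z : Pos d × Pos d, G' (z.1 + s • z.2, z.2) ≤ mixedMass p G := by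
    rw [(measurePreserving_shear s).lintegral_comp hG']
    exact lintegral_mul_rpow_le_mixedMass hG
  -- A shear by `s` straightens the argument of `β` to `x`; the integral in `v` of the other factor
  -- then decouples with Jacobian `|t - s|^{-d}`.
  have iαβ : ∫⁻ z : Pos d × Pos d, α (z.1 + t • z.2) * β (z.1 + s • z.2) =
      ENNReal.ofReal |t - s| ^ (-(d : ℝ)) * mixedMass p F * mixedMass p G := by
    have hH : Measurable fun z : Pos d × Pos d => α (z.1 + (t - s) • z.2) * β z.1 := by fun_prop
    have := (measurePreserving_shear (d := d) s).lintegral_comp hH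
    have e : ∀ z : Pos d × Pos d, z.1 + s • z.2 + (t - s) • z.2 = z.1 + t • z.2 := fun z => by
      rw [sub_smul]; abel
    simp only [e] at this
    rw [this, Measure.volume_eq_prod, lintegral_prod _ hH.aemeasurable]
    have : ∀ x : Pos d, ∫⁻ v, α (x + (t - s) • v) * β x =
        ENNReal.ofReal |t - s| ^ (-(d : ℝ)) * mixedMass p F * β x := fun x => by
      rw [lintegral_mul_const _ (by fun_prop), lintegral_comp_add_smul hα x hτ]; rfl
    simp only [this]
    rw [lintegral_const_mul _ hβ]; rfl
  -- Hölder with weights `1/p`, `1/p`, `1 - 2/p`: the first two factors are conserved by the flow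
  -- and only the third disperses.
  calc _ ≤ ∫⁻ z : Pos d × Pos d, F' (z.1 + t • z.2, z.2) ^ (1 / p) *
        G' (z.1 + s • z.2, z.2) ^ (1 / p) *
          (α (z.1 + t • z.2) * β (z.1 + s • z.2)) ^ (1 - 2 / p) := by
        refine lintegral_mono_ae ?_
        filter_upwards [eF, eG] with z hz1 hz2
        refine (mul_le_mul' hz1 hz2).trans (le_of_eq ?_)
        rw [ENNReal.mul_rpow_of_nonneg (α _) _ h2p.le]
        simp only [F', G', α, β, a, b]
        ring
    _ ≤ (∫⁻ z : Pos d × Pos d, F' (z.1 + t • z.2, z.2)) ^ (1 / p) *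
        (∫⁻ z : Pos d × Pos d, G' (z.1 + s • z.2, z.2)) ^ (1 / p) *
          (∫⁻ z : Pos d × Pos d, α (z.1 + t • z.2) * β (z.1 + s • z.2)) ^ (1 - 2 / p) := by
        have hαβ : Measurable fun z : Pos d × Pos d => α (z.1 + t • z.2) * β (z.1 + s • z.2) := by
          fun_prop
        have := ENNReal.lintegral_prod_norm_pow_le (μ := (volume : Measure (Pos d × Pos d)))
          (Finset.univ : Finset (Fin 3))
          (f := ![fun z => F' (z.1 + t • z.2, z.2), fun z => G' (z.1 + s • z.2, z.2),
            fun z => α (z.1 + t • z.2) * β (z.1 + s • z.2)])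
          (p := ![1 / p, 1 / p, 1 - 2 / p])
          (by
            intro i _
            fin_cases i
            · exact (hF'.comp (measurePreserving_shear t).measurable).aemeasurable
            · exact (hG'.comp (measurePreserving_shear s).measurable).aemeasurable
            · exact hαβ.aemeasurable)
          (by simp [Fin.sum_univ_three]; ring)
          (by
            intro i _
            fin_cases i
            · exact (by positivity : 0 ≤ 1 / p)
            · exact (by positivity : 0 ≤ 1 / p)
            · exact h2p.le)
        simpa [Fin.prod_univ_three] using this
    _ ≤ mixedMass p F ^ (1 / p) * mixedMass p G ^ (1 / p) *
        (ENNReal.ofReal |t - s| ^ (-(d : ℝ)) * mixedMass p F * mixedMass p G) ^ (1 - 2 / p) := by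
        rw [iαβ]
        gcongr
    _ = _ := by
        rw [ENNReal.mul_rpow_of_nonneg _ _ h2p.le, ENNReal.mul_rpow_of_nonneg _ _ h2p.le,
          ← ENNReal.rpow_mul, show 1 - 1 / p = 1 / p + (1 - 2 / p) by ring,
          ENNReal.rpow_add _ _ hF0 hFt, ENNReal.rpow_add _ _ hG0 hGt,
          show -(d : ℝ) * (1 - 2 / p) = -(d * (1 - 2 / p)) by ring]
        ring

/-! ### The `T T*` argument. -/

/-- The `T T*` estimate: the averages of `g (t, x, v)` along free trajectories are controlled in
`L²`. -/
theorem lintegral_sq_lintegral_shear_le {d : ℕ} (hd : 1 ≤ d) {p q : ℝ} (hp : 2 < p) (hq : 2 < q)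
    (hpq : 2 / q = d * (1 - 2 / p)) :
    ∃ C : ℝ≥0, ∀ g : ℝ × Pos d × Pos d → ℝ≥0∞, Measurable g →
      ∫⁻ z : Pos d × Pos d, (∫⁻ t, g (t, z.1 + t • z.2, z.2)) ^ (2 : ℝ) ≤
        C * (∫⁻ t, (mixedMass p (fun z => g (t, z)) ^ (1 - 1 / p)) ^ (q / (q - 1))) ^
          (2 * (1 - 1 / q)) := by
  have hq0 : 0 < q := by linarith
  obtain ⟨C, -, hC⟩ := lintegral_lintegral_mul_mul_rpow_neg_le (l := 2 / q) (by positivity)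
    (by rwa [div_lt_one hq0])
  refine ⟨C, fun g hg => ?_⟩
  have hM : Measurable fun t => mixedMass p (fun z => g (t, z)) ^ (1 - 1 / p) := by
    unfold mixedMass
    fun_prop
  have hq1 : q - 1 ≠ 0 := by linarith
  have e1 : 2 / (2 - 2 / q) = q / (q - 1) := by
    rw [show 2 - 2 / q = 2 * (q - 1) / q by field_simp]
    field_simp
  have e2 : 2 - 2 / q = 2 * (1 - 1 / q) := by ring
  rw [e1, e2] at hC
  refine le_trans ?_ (hC _ hM)
  have h1 : ∀ z : Pos d × Pos d, (∫⁻ t, g (t, z.1 + t • z.2, z.2)) ^ (2 : ℝ) =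
      ∫⁻ t, ∫⁻ s, g (t, z.1 + t • z.2, z.2) * g (s, z.1 + s • z.2, z.2) := fun z => by
    rw [ENNReal.rpow_two, sq, lintegral_lintegral_mul (Measurable.aemeasurable (by fun_prop))
      (Measurable.aemeasurable (by fun_prop))]
  simp only [h1]
  rw [lintegral_lintegral_swap (Measurable.aemeasurable (by fun_prop))]
  refine lintegral_mono fun t => ?_
  rw [lintegral_lintegral_swap (Measurable.aemeasurable (by fun_prop))]
  refine lintegral_mono fun s => ?_
  rw [hpq]
  exact lintegral_shear_mul_shear_le hd hp (F := fun z => g (t, z)) (G := fun z => g (s, z))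
    (by fun_prop) (by fun_prop) t s

/-! ### Duality in mixed norms. -/

theorem ENNReal.mul_rpow_eq_rpow_one_add {x : ℝ≥0∞} (hx : x ≠ ∞) (y : ℝ) (hy : 0 < 1 + y) :
    x * x ^ y = x ^ (1 + y) := by
  rcases eq_or_ne x 0 with h0 | h0
  · rw [h0, zero_mul, ENNReal.zero_rpow_of_pos hy]
  · rw [ENNReal.rpow_add _ _ h0 hx, ENNReal.rpow_one]

/-- The absorption step of each duality argument. Finiteness of `X` is what permits division, and is
the reason for the truncations below. -/
theorem ENNReal.le_rpow_of_le_mul_rpow {X K : ℝ≥0∞} (hX : X ≠ ∞) {q : ℝ} (hq : 0 < q)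
    (h : X ≤ K * X ^ (1 - 1 / q)) : X ≤ K ^ q := by
  rcases eq_or_ne X 0 with h0 | h0
  · simp [h0]
  have h1 : X ^ (1 - 1 / q) ≠ 0 := by simp [ENNReal.rpow_eq_zero_iff, h0, hX]
  have h2 : X ^ (1 - 1 / q) ≠ ∞ := by simp [ENNReal.rpow_eq_top_iff, h0, hX]
  have h3 : X = X ^ (1 / q) * X ^ (1 - 1 / q) := by
    rw [← ENNReal.rpow_add _ _ h0 hX]; simp
  have h4 : X ^ (1 / q) ≤ K := by
    nth_rewrite 1 [h3] at h
    exact (ENNReal.mul_le_mul_iff_left h1 h2).1 h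
  calc X = (X ^ (1 / q)) ^ q := by rw [← ENNReal.rpow_mul, one_div_mul_cancel hq.ne', ENNReal.rpow_one]
    _ ≤ K ^ q := by gcongr

/-- `∫ ‖h(t, ·, ·)‖^q dt` for the norm of `L^p_x L^r_v`. -/
noncomputable def mixedLintegral {d : ℕ} (q p r : ℝ) (h : ℝ × Pos d × Pos d → ℝ≥0∞) : ℝ≥0∞ :=
  ∫⁻ t, (∫⁻ x, (∫⁻ v, h (t, x, v) ^ r) ^ (p / r)) ^ (q / p)

theorem mixedLintegral_le_of_forall_lintegral_mul_le {d : ℕ} {p q : ℝ} (hp : 2 < p) (hq : 2 < q)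
    {h : ℝ × Pos d × Pos d → ℝ≥0∞} (hh : Measurable h)
    (hX : mixedLintegral q p (p / (p - 1)) h ≠ ∞) {K : ℝ≥0∞}
    (hK : ∀ g : ℝ × Pos d × Pos d → ℝ≥0∞, Measurable g →
      ∫⁻ t, ∫⁻ x, ∫⁻ v, h (t, x, v) * g (t, x, v) ≤
        K * (∫⁻ t, (mixedMass p (fun z => g (t, z)) ^ (1 - 1 / p)) ^ (q / (q - 1))) ^
          (1 - 1 / q)) :
    mixedLintegral q p (p / (p - 1)) h ≤ K ^ q := by
  have hp0 : 0 < p := by linarith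
  have hp1 : 0 < p - 1 := by linarith
  have hp2 : 0 < p - 2 := by linarith
  have hq0 : 0 < q := by linarith
  have hq1 : 0 < q - 1 := by linarith
  refine ENNReal.le_rpow_of_le_mul_rpow hX hq0 ?_
  set r := p / (p - 1) with hr
  have hr1 : r - 1 = 1 / (p - 1) := by rw [hr]; field_simp; ring
  have hr0 : 0 < r - 1 := by rw [hr1]; positivity
  have hpr : p / r = p - 1 := by rw [hr]; field_simp
  set A : ℝ × Pos d → ℝ≥0∞ := fun y => ∫⁻ v, h (y.1, y.2, v) ^ r
  have hA : Measurable A := by fun_prop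
  set B : ℝ → ℝ≥0∞ := fun t => ∫⁻ x, A (t, x) ^ (p - 1)
  have hB : Measurable B := by fun_prop
  have hXB : mixedLintegral q p r h = ∫⁻ t, B t ^ (q / p) := by
    simp only [mixedLintegral, hpr, A, B]
  have hBt : ∀ᵐ t, B t ≠ ∞ := by
    rw [hXB] at hX
    filter_upwards [ae_lt_top (by fun_prop) hX] with t ht h
    rw [h, ENNReal.top_rpow_of_pos (by positivity)] at ht
    exact ht.ne rfl
  -- The extremizer of the duality pairing, without normalization: both the pairing with `h` and the
  -- integral in the dual norm equal `mixedLintegral q p r h`. The power of `B` may be negative, so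
  -- `B` must be finite almost everywhere.
  set g : ℝ × Pos d × Pos d → ℝ≥0∞ := fun y =>
    B y.1 ^ (q / p - 1) * (A (y.1, y.2.1) ^ (p - 2) * h y ^ (r - 1))
  have hg : Measurable g := by fun_prop
  have hleft : ∫⁻ t, ∫⁻ x, ∫⁻ v, h (t, x, v) * g (t, x, v) = mixedLintegral q p r h := by
    rw [hXB]
    refine lintegral_congr_ae ?_
    filter_upwards [hBt] with t ht
    have e : ∀ x, ∫⁻ v, h (t, x, v) * g (t, x, v) = B t ^ (q / p - 1) * A (t, x) ^ (p - 1) := by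
      intro x
      have e' : ∀ v, h (t, x, v) * g (t, x, v) =
          B t ^ (q / p - 1) * (A (t, x) ^ (p - 2) * h (t, x, v) ^ r) := by
        intro v
        have : h (t, x, v) ^ r = h (t, x, v) ^ (r - 1) * h (t, x, v) := by
          nth_rewrite 3 [← ENNReal.rpow_one (h (t, x, v))]
          rw [← ENNReal.rpow_add_of_nonneg _ _ hr0.le zero_le_one]; simp
        simp only [g, this]; ring
      simp only [e']
      rw [lintegral_const_mul _ (by fun_prop), lintegral_const_mul _ (by fun_prop)]
      congr 1
      rw [show ∫⁻ v, h (t, x, v) ^ r = A (t, x) from rfl]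
      nth_rewrite 2 [← ENNReal.rpow_one (A (t, x))]
      rw [← ENNReal.rpow_add_of_nonneg _ _ hp2.le zero_le_one]
      congr 1; ring
    simp only [e]
    rw [lintegral_const_mul _ (by fun_prop), mul_comm, show ∫⁻ x, A (t, x) ^ (p - 1) = B t from rfl,
      ENNReal.mul_rpow_eq_rpow_one_add ht]
    · congr 1; ring
    · have : 0 < q / p := by positivity
      linarith
  have hright : ∫⁻ t, (mixedMass p (fun z => g (t, z)) ^ (1 - 1 / p)) ^ (q / (q - 1)) =
      mixedLintegral q p r h := by
    rw [hXB]
    refine lintegral_congr_ae ?_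
    filter_upwards [hBt] with t ht
    have e : ∀ x, (∫⁻ v, g (t, x, v) ^ p) ^ (1 / (p - 1)) =
        B t ^ ((q - p) / (p - 1)) * A (t, x) ^ (p - 1) := by
      intro x
      have e' : ∀ v, g (t, x, v) ^ p =
          B t ^ ((q / p - 1) * p) * (A (t, x) ^ ((p - 2) * p) * h (t, x, v) ^ r) := by
        intro v
        simp only [g]
        rw [ENNReal.mul_rpow_of_nonneg _ _ hp0.le, ENNReal.mul_rpow_of_nonneg _ _ hp0.le,
          ← ENNReal.rpow_mul, ← ENNReal.rpow_mul, ← ENNReal.rpow_mul,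
          show (r - 1) * p = r by rw [hr1, hr]; ring]
      simp only [e']
      rw [lintegral_const_mul _ (by fun_prop), lintegral_const_mul _ (by fun_prop),
        ENNReal.mul_rpow_of_nonneg _ _ (by positivity), ← ENNReal.rpow_mul,
        show ∫⁻ v, h (t, x, v) ^ r = A (t, x) from rfl]
      congr 1
      · congr 1; field_simp
      · nth_rewrite 2 [← ENNReal.rpow_one (A (t, x))]
        rw [← ENNReal.rpow_add_of_nonneg _ _ (by positivity) zero_le_one, ← ENNReal.rpow_mul]
        congr 1; field_simp; ring
    simp only [mixedMass, e]
    rw [lintegral_const_mul _ (by fun_prop), mul_comm, show ∫⁻ x, A (t, x) ^ (p - 1) = B t from rfl,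
      ENNReal.mul_rpow_eq_rpow_one_add ht, ← ENNReal.rpow_mul, ← ENNReal.rpow_mul]
    · congr 1; field_simp; ring
    · rw [show 1 + (q - p) / (p - 1) = (q - 1) / (p - 1) by field_simp; ring]
      positivity
  have := hK g hg
  rwa [hleft, hright] at this

/-- Duality form of the transport estimate at `a = 2`. -/
theorem lintegral_transport_mul_le {d : ℕ} (hd : 1 ≤ d) {p q : ℝ} (hp : 2 < p) (hq : 2 < q)
    (hpq : 2 / q = d * (1 - 2 / p)) :
    ∃ C : ℝ≥0, ∀ f : Pos d × Pos d → ℝ≥0∞, Measurable f →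
      ∀ g : ℝ × Pos d × Pos d → ℝ≥0∞, Measurable g →
        ∫⁻ t, ∫⁻ x, ∫⁻ v, f (x - t • v, v) * g (t, x, v) ≤
          C * (∫⁻ z, f z ^ (2 : ℝ)) ^ (1 / 2 : ℝ) *
            (∫⁻ t, (mixedMass p (fun z => g (t, z)) ^ (1 - 1 / p)) ^ (q / (q - 1))) ^
              (1 - 1 / q) := by
  obtain ⟨C, hC⟩ := lintegral_sq_lintegral_shear_le hd hp hq hpq
  refine ⟨C ^ (1 / 2 : ℝ), fun f hf g hg => ?_⟩
  -- The shear moves the flow from `f` to `g`, so that Cauchy–Schwarz in phase space isolates the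
  -- time average of `g`.
  have h1 : ∀ t : ℝ, ∫⁻ x, ∫⁻ v, f (x - t • v, v) * g (t, x, v) =
      ∫⁻ z : Pos d × Pos d, f z * g (t, z.1 + t • z.2, z.2) := fun t => by
    have hm : Measurable fun z : Pos d × Pos d => f (z.1 - t • z.2, z.2) * g (t, z.1, z.2) := by
      fun_prop
    have := (measurePreserving_shear (d := d) t).lintegral_comp hm
    simp only [add_sub_cancel_right] at this
    rw [this, Measure.volume_eq_prod, lintegral_prod _ hm.aemeasurable]
  simp only [h1]
  rw [lintegral_lintegral_swap (Measurable.aemeasurable (by fun_prop))]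
  have h2 : ∀ z : Pos d × Pos d, ∫⁻ t, f z * g (t, z.1 + t • z.2, z.2) =
      f z * ∫⁻ t, g (t, z.1 + t • z.2, z.2) := fun z => by
    rw [lintegral_const_mul _ (by fun_prop)]
  simp only [h2]
  refine (ENNReal.lintegral_mul_le_Lp_mul_Lq volume Real.HolderConjugate.two_two
    hf.aemeasurable (g := fun z : Pos d × Pos d => ∫⁻ t, g (t, z.1 + t • z.2, z.2))
    (Measurable.aemeasurable (by fun_prop))).trans ?_
  rw [mul_comm ((C ^ (1 / 2 : ℝ) : ℝ≥0) : ℝ≥0∞), mul_assoc]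
  gcongr
  refine (ENNReal.rpow_le_rpow (hC g hg) (by norm_num)).trans (le_of_eq ?_)
  rw [ENNReal.mul_rpow_of_nonneg _ _ (by norm_num), ← ENNReal.rpow_mul,
    ← ENNReal.coe_rpow_of_nonneg _ (by norm_num)]
  congr 2; ring

/-! ### Truncation and monotone limits. -/

theorem mixedLintegral_ne_top_of_le_indicator {d : ℕ} {q p r : ℝ} (hq : 0 < q) (hp : 0 < p)
    (hr : 0 < r) {h : ℝ × Pos d × Pos d → ℝ≥0∞} {T : Set ℝ} {S : Set (Pos d)} {k : ℝ≥0∞}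
    (hk : k ≠ ∞) (hT : MeasurableSet T) (hS : MeasurableSet S) (hvT : volume T ≠ ∞)
    (hvS : volume S ≠ ∞) (hh : ∀ t x v, h (t, x, v) ≤
      T.indicator 1 t * (S.indicator 1 x * (S.indicator (fun _ => k) v))) :
    mixedLintegral q p r h ≠ ∞ := by
  have hind : ∀ {α : Type} (U : Set α) (y : α) {s : ℝ}, 0 < s →
      (U.indicator (1 : α → ℝ≥0∞) y) ^ s = U.indicator 1 y := by
    intro α U y s hs
    by_cases hy : y ∈ U <;> simp [hy, hs]
  have hpr : 0 < p / r := by positivity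
  have hqp : 0 < q / p := by positivity
  have hA : ∀ t x, (∫⁻ v, h (t, x, v) ^ r) ^ (p / r) ≤
      T.indicator 1 t * (S.indicator 1 x * (k ^ r * volume S) ^ (p / r)) := by
    intro t x
    calc _ ≤ (∫⁻ v, T.indicator 1 t * (S.indicator 1 x *
          S.indicator (fun _ => k ^ r) v)) ^ (p / r) := by
          gcongr with v
          refine (ENNReal.rpow_le_rpow (hh t x v) hr.le).trans (le_of_eq ?_)
          rw [ENNReal.mul_rpow_of_nonneg _ _ hr.le, ENNReal.mul_rpow_of_nonneg _ _ hr.le,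
            hind _ _ hr, hind _ _ hr]
          by_cases hv : v ∈ S <;> simp [hv, hr]
      _ = _ := by
          rw [lintegral_const_mul _ (by fun_prop (disch := assumption)),
            lintegral_const_mul _ (by fun_prop (disch := assumption)), lintegral_indicator hS,
            setLIntegral_const, ENNReal.mul_rpow_of_nonneg _ _ hpr.le,
            ENNReal.mul_rpow_of_nonneg _ _ hpr.le, hind _ _ hpr, hind _ _ hpr]
  set c := (k ^ r * volume S) ^ (p / r)
  have hc : c ≠ ∞ := ENNReal.rpow_ne_top_of_nonneg hpr.le
    (ENNReal.mul_ne_top (ENNReal.rpow_ne_top_of_nonneg hr.le hk) hvS)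
  have hB : ∀ t, (∫⁻ x, (∫⁻ v, h (t, x, v) ^ r) ^ (p / r)) ^ (q / p) ≤
      T.indicator 1 t * (volume S * c) ^ (q / p) := by
    intro t
    calc _ ≤ (∫⁻ x, T.indicator 1 t * (S.indicator 1 x * c)) ^ (q / p) := by
          gcongr with x; exact hA t x
      _ = _ := by
          have : Measurable (S.indicator (1 : Pos d → ℝ≥0∞)) := measurable_one.indicator hS
          rw [lintegral_const_mul _ (by fun_prop), lintegral_mul_const _ (by fun_prop),
            lintegral_indicator_one hS, ENNReal.mul_rpow_of_nonneg _ _ hqp.le, hind _ _ hqp]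
  refine ne_top_of_le_ne_top ?_ (lintegral_mono hB)
  rw [lintegral_mul_const _ (measurable_one.indicator hT), lintegral_indicator_one hT]
  exact ENNReal.mul_ne_top hvT (ENNReal.rpow_ne_top_of_nonneg hqp.le (ENNReal.mul_ne_top hvS hc))

theorem tendsto_mixedLintegral {d : ℕ} {q p r : ℝ} (hq : 0 < q) (hp : 0 < p)
    (hr : 0 < r) {h : ℝ × Pos d × Pos d → ℝ≥0∞} {H : ℕ → ℝ × Pos d × Pos d → ℝ≥0∞}
    (hH : ∀ k, Measurable (H k)) (hmono : ∀ y, Monotone fun k => H k y)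
    (hlim : ∀ y, Filter.Tendsto (fun k => H k y) Filter.atTop (nhds (h y))) :
    Filter.Tendsto (fun k => mixedLintegral q p r (H k)) Filter.atTop
      (nhds (mixedLintegral q p r h)) := by
  have hpr : 0 < p / r := by positivity
  have hqp : 0 < q / p := by positivity
  have hh : Measurable h := measurable_of_tendsto_metrizable hH (tendsto_pi_nhds.2 hlim)
  have pm : ∀ {s : ℝ} {u : ℕ → ℝ≥0∞}, 0 < s → Monotone u → Monotone fun k => u k ^ s :=
    fun hs hu i j hij => ENNReal.rpow_le_rpow (hu hij) hs.le
  have pt : ∀ {s : ℝ} {u : ℕ → ℝ≥0∞} {x : ℝ≥0∞}, Filter.Tendsto u Filter.atTop (nhds x) →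
      Filter.Tendsto (fun k => u k ^ s) Filter.atTop (nhds (x ^ s)) :=
    fun {s} _ _ hu => (ENNReal.continuous_rpow_const (y := s)).continuousAt.tendsto.comp hu
  unfold mixedLintegral
  have m1 : ∀ t x, Monotone fun k => ∫⁻ v, H k (t, x, v) ^ r := fun t x i j hij =>
    lintegral_mono fun v => pm hr (hmono (t, x, v)) hij
  have m2 : ∀ t, Monotone fun k => ∫⁻ x, (∫⁻ v, H k (t, x, v) ^ r) ^ (p / r) := fun t i j hij =>
    lintegral_mono fun x => pm hpr (m1 t x) hij
  refine lintegral_tendsto_of_tendsto_of_monotone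
    (fun k => Measurable.aemeasurable (by have := hH k; fun_prop))
    (Filter.Eventually.of_forall fun t => pm hqp (m2 t))
    (Filter.Eventually.of_forall fun t => pt ?_)
  refine lintegral_tendsto_of_tendsto_of_monotone
    (fun k => Measurable.aemeasurable (by have := hH k; fun_prop))
    (Filter.Eventually.of_forall fun x => pm hpr (m1 t x))
    (Filter.Eventually.of_forall fun x => pt ?_)
  exact lintegral_tendsto_of_tendsto_of_monotone
    (fun k => Measurable.aemeasurable (by have := hH k; fun_prop))
    (Filter.Eventually.of_forall fun v => pm hr (hmono (t, x, v)))
    (Filter.Eventually.of_forall fun v => pt (hlim (t, x, v)))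

theorem exists_bounded_approximation {E : Type*} [PseudoMetricSpace E] [MeasurableSpace E]
    [OpensMeasurableSpace E] (x₀ : E) {W : E → ℝ≥0∞} (hW : Measurable W) :
    ∃ V : ℕ → E → ℝ≥0∞, (∀ k, Measurable (V k)) ∧ (∀ y, Monotone fun k => V k y) ∧
      (∀ y, Filter.Tendsto (fun k => V k y) Filter.atTop (nhds (W y))) ∧ (∀ k y, V k y ≤ W y) ∧
      ∀ (k : ℕ) y, V k y ≤ (Metric.closedBall x₀ (k : ℝ)).indicator (fun _ => (k : ℝ≥0∞)) y := by
  refine ⟨fun k => (Metric.closedBall x₀ k).indicator fun y => min (W y) k,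
    fun k => (hW.min measurable_const).indicator measurableSet_closedBall,
    fun y i j hij => ?_, fun y => ?_, fun k y =>
      (Set.indicator_le_self' (fun _ _ => zero_le) y).trans (min_le_left _ _),
    fun k y => Set.indicator_le_indicator (min_le_right _ _)⟩
  · refine (Set.indicator_le_indicator_of_subset (Metric.closedBall_subset_closedBall
      (Nat.cast_le.2 hij)) (fun _ => zero_le) y).trans ?_
    refine Set.indicator_le_indicator ?_
    gcongr
  · have : Filter.Tendsto (fun k : ℕ => min (W y) k) Filter.atTop (nhds (min (W y) ∞)) :=
      tendsto_const_nhds.min ENNReal.tendsto_nat_nhds_top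
    rw [min_eq_left le_top] at this
    refine this.congr' ?_
    obtain ⟨n, hn⟩ := exists_nat_ge (dist y x₀)
    filter_upwards [Filter.eventually_ge_atTop n] with k hk
    have : y ∈ Metric.closedBall x₀ (k : ℝ) := hn.trans (by exact_mod_cast hk)
    simp only [Set.indicator_of_mem this]

/-! ### Strichartz estimates for nonnegative data. -/

theorem mixedLintegral_transport_le_of_two {d : ℕ} (hd : 1 ≤ d) {p q : ℝ} (hp : 2 < p) (hq : 2 < q)
    (hpq : 2 / q = d * (1 - 2 / p)) :
    ∃ C : ℝ≥0, ∀ f : Pos d × Pos d → ℝ≥0∞, Measurable f →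
      mixedLintegral q p (p / (p - 1)) (fun y => f (y.2.1 - y.1 • y.2.2, y.2.2)) ≤
        C * (∫⁻ z, f z ^ (2 : ℝ)) ^ (q / 2) := by
  obtain ⟨C, hC⟩ := lintegral_transport_mul_le hd hp hq hpq
  have hp0 : 0 < p := by linarith
  have hq0 : 0 < q := by linarith
  have hr : 0 < p / (p - 1) := div_pos hp0 (by linarith)
  refine ⟨C ^ q, fun f hf => ?_⟩
  set h : ℝ × Pos d × Pos d → ℝ≥0∞ := fun y => f (y.2.1 - y.1 • y.2.2, y.2.2)
  have hh : Measurable h := by fun_prop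
  -- The norm of `h` is not known to be finite, so duality is applied to truncations of `h`. They
  -- need not be transported data: the pairing bound only uses that they lie below `h`.
  obtain ⟨H, hH, hmono, hlim, hHle, hHind⟩ := exists_bounded_approximation 0 hh
  refine le_of_tendsto' (tendsto_mixedLintegral hq0 hp0 hr hH hmono hlim) fun k => ?_
  have hfin : mixedLintegral q p (p / (p - 1)) (H k) ≠ ∞ := by
    refine mixedLintegral_ne_top_of_le_indicator hq0 hp0 hr (k := k)
      (T := Metric.closedBall 0 k) (S := Metric.closedBall 0 k) (by simp)
      measurableSet_closedBall measurableSet_closedBall measure_closedBall_lt_top.ne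
      measure_closedBall_lt_top.ne fun t x v => ?_
    refine (hHind k (t, x, v)).trans ?_
    by_cases hy : (t, x, v) ∈ Metric.closedBall (0 : ℝ × Pos d × Pos d) (k : ℝ)
    · rw [Set.indicator_of_mem hy]
      simp only [mem_closedBall_zero_iff, Prod.norm_mk, sup_le_iff] at hy
      simp [Set.indicator, hy.1, hy.2.1, hy.2.2, -Real.norm_eq_abs]
    · rw [Set.indicator_of_notMem hy]
      exact zero_le
  refine (mixedLintegral_le_of_forall_lintegral_mul_le hp hq (hH k) hfin
    (K := C * (∫⁻ z, f z ^ (2 : ℝ)) ^ (1 / 2 : ℝ)) fun g hg => ?_).trans (le_of_eq ?_)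
  · refine le_trans ?_ (hC f hf g hg)
    gcongr with t x v
    exact hHle k (t, x, v)
  · rw [ENNReal.mul_rpow_of_nonneg _ _ hq0.le, ← ENNReal.rpow_mul,
      ENNReal.coe_rpow_of_nonneg _ hq0.le]
    congr 2; ring

theorem mixedLintegral_transport_le {d : ℕ} (hd : 1 ≤ d) {q p r a : ℝ} (hr : 0 < r) (ha : 0 < a)
    (hscal : 2 / q = d * (1 / r - 1 / p)) (hmean : 1 / a = (1 / r + 1 / p) / 2)
    (haq : a < q) (hap : a < p) :
    ∃ C : ℝ≥0, ∀ f : Pos d × Pos d → ℝ≥0∞, Measurable f →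
      mixedLintegral q p r (fun y => f (y.2.1 - y.1 • y.2.2, y.2.2)) ≤
        C * (∫⁻ z, f z ^ a) ^ (q / a) := by
  have hq : 0 < q := ha.trans haq
  have hp : 0 < p := ha.trans hap
  have hr' : 1 / r = 2 / a - 1 / p := by linear_combination (-2) * hmean
  have hpr : 2 * p / a - 1 = p / r := by
    rw [show p / r = p * (1 / r) by ring, hr']; field_simp
  -- The exponents of the estimate for `f^{a/2}`; the conjugate of `2p/a` is `2r/a` by the relation
  -- for the mean.
  obtain ⟨C, hC⟩ := mixedLintegral_transport_le_of_two hd (p := 2 * p / a) (q := 2 * q / a)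
    (by rw [lt_div_iff₀ ha]; linarith) (by rw [lt_div_iff₀ ha]; linarith) (by
      have : 2 / (2 * q / a) = a / 2 * (2 / q) := by field_simp
      rw [this, hscal, hr']; field_simp; ring)
  refine ⟨C, fun f hf => ?_⟩
  have := hC (fun z => f z ^ (a / 2)) (by fun_prop)
  rw [hpr] at this
  simp only [mixedLintegral, ← ENNReal.rpow_mul] at this ⊢
  have e1 : a / 2 * (2 * p / a / (p / r)) = r := by field_simp
  have e2 : 2 * p / a / (2 * p / a / (p / r)) = p / r := by field_simp
  have e3 : 2 * q / a / (2 * p / a) = q / p := by field_simp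
  have e4 : a / 2 * 2 = a := by ring
  have e5 : 2 * q / a / 2 = q / a := by ring
  rwa [e1, e2, e3, e4, e5] at this

/-! ### The estimate for `ρ*`, by duality with velocity averages. -/

theorem lintegral_rpow_le_of_forall_lintegral_mul_le {E : Type*} [PseudoMetricSpace E]
    [ProperSpace E] [MeasurableSpace E] [OpensMeasurableSpace E] {μ : Measure E}
    [IsFiniteMeasureOnCompacts μ] (x₀ : E) {b : ℝ} (hb : 1 < b) {W : E → ℝ≥0∞} (hW : Measurable W)
    {K : ℝ≥0∞} (hK : ∀ φ : E → ℝ≥0∞, Measurable φ →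
      ∫⁻ z, W z * φ z ∂μ ≤ K * (∫⁻ z, φ z ^ (b / (b - 1)) ∂μ) ^ (1 - 1 / b)) :
    ∫⁻ z, W z ^ b ∂μ ≤ K ^ b := by
  have hb0 : 0 < b := by linarith
  have hb1 : 0 < b - 1 := by linarith
  obtain ⟨V, hV, hmono, hlim, hVle, hVind⟩ := exists_bounded_approximation x₀ hW
  refine le_of_tendsto' (lintegral_tendsto_of_tendsto_of_monotone
    (f := fun k z => V k z ^ b) (fun k => ((hV k).pow_const b).aemeasurable)
    (Filter.Eventually.of_forall fun z i j hij => ENNReal.rpow_le_rpow (hmono z hij) hb0.le)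
    (Filter.Eventually.of_forall fun z =>
      (ENNReal.continuous_rpow_const (y := b)).continuousAt.tendsto.comp (hlim z))) fun k => ?_
  refine ENNReal.le_rpow_of_le_mul_rpow ?_ hb0 ?_
  · refine ne_top_of_le_ne_top ?_ (lintegral_mono
      (g := (Metric.closedBall x₀ (k : ℝ)).indicator fun _ => (k : ℝ≥0∞) ^ b) fun z => ?_)
    · rw [lintegral_indicator measurableSet_closedBall, setLIntegral_const]
      exact ENNReal.mul_ne_top (ENNReal.rpow_ne_top_of_nonneg hb0.le (by simp))
        measure_closedBall_lt_top.ne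
    · by_cases hz : z ∈ Metric.closedBall x₀ (k : ℝ)
      · have := hVind k z
        simp only [Set.indicator_of_mem hz] at this ⊢
        gcongr
      · have := hVind k z
        simp only [Set.indicator_of_notMem hz, nonpos_iff_eq_zero] at this ⊢
        rw [this, ENNReal.zero_rpow_of_pos hb0]
  · have h := hK (fun z => V k z ^ (b - 1)) ((hV k).pow_const _)
    simp only [← ENNReal.rpow_mul, show (b - 1) * (b / (b - 1)) = b by field_simp] at h
    refine le_trans (lintegral_mono fun z => ?_) h
    simp only
    nth_rewrite 1 [show b = 1 + (b - 1) by ring]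
    rw [ENNReal.rpow_add_of_nonneg _ _ zero_le_one hb1.le, ENNReal.rpow_one]
    gcongr
    exact hVle k z

theorem lintegral_rpow_lintegral_line_le {d : ℕ} (hd : 1 ≤ d) {σ q : ℝ} (hσ : 1 < σ)
    (hq : 1 / q + d / ((d + 1) * σ) = 1) :
    ∃ C : ℝ≥0, ∀ G : ℝ × Pos d → ℝ≥0∞, Measurable G →
      ∫⁻ z : Pos d × Pos d, (∫⁻ t, G (t, z.1 + t • z.2)) ^ (σ * (d + 1)) ≤
        C * (∫⁻ t, (∫⁻ x, G (t, x) ^ ((d + 1) * σ / 2)) ^ (q / ((d + 1) * σ / 2))) ^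
          (σ * (d + 1) / q) := by
  have hd1 : (1 : ℝ) ≤ d := by exact_mod_cast hd
  set b := σ * (d + 1) with hb
  have hdb : (d : ℝ) + 1 < b := by nlinarith
  have hb0 : 0 < b := by linarith
  have hb1 : 0 < b - 1 := by linarith
  have hb2 : 0 < b - 2 := by linarith
  rw [show ((d : ℝ) + 1) * σ = b by rw [hb]; ring] at hq ⊢
  have hdb' : (d : ℝ) / b < 1 := by rw [div_lt_one hb0]; linarith
  have hq' : 1 / q = 1 - d / b := by linarith
  have hq0 : 0 < q := by
    rw [← one_div_pos, hq']; linarith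
  have hq1 : 1 < q := by
    rw [← one_div_lt_one_div (by linarith) zero_lt_one]
    rw [hq']
    have : 0 < (d : ℝ) / b := by positivity
    linarith
  have hconj := Real.HolderConjugate.conjExponent hq1
  have hconjP : (b / 2).HolderConjugate (b / (b - 2)) := by
    rw [Real.holderConjugate_iff]
    constructor
    · linarith
    · field_simp; ring
  have hqc : 1 / q.conjExponent = d / b := by
    have := hconj.inv_add_inv_eq_one
    rw [← one_div, ← one_div] at this
    linarith
  have hqc0 : 0 < q.conjExponent := hconj.symm.pos
  -- These are the conjugates of `q`, `b/2` and `b`, and `r = 1` is the velocity average. The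
  -- condition that `a` be below the time exponent reads `d/b < (b-1)/b`, that is `d + 1 < b`, which
  -- is `σ > 1`.
  obtain ⟨C, hC⟩ := mixedLintegral_transport_le hd (q := q.conjExponent) (p := b / (b - 2))
    (r := 1) (a := b / (b - 1)) zero_lt_one (by positivity)
    (by
      rw [show 2 / q.conjExponent = 2 * (1 / q.conjExponent) by ring, hqc]
      field_simp; ring)
    (by field_simp; ring)
    (by
      rw [← one_div_lt_one_div hqc0 (by positivity), hqc, one_div_div]
      gcongr; linarith)
    (by gcongr; linarith)
  refine ⟨(C ^ (1 / q.conjExponent)) ^ b, fun G hG => ?_⟩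
  set X := ∫⁻ t, (∫⁻ x, G (t, x) ^ (b / 2)) ^ (q / (b / 2)) with hX
  have hW : Measurable fun z : Pos d × Pos d => ∫⁻ t, G (t, z.1 + t • z.2) := by fun_prop
  refine (lintegral_rpow_le_of_forall_lintegral_mul_le (x₀ := 0) (b := b) (by linarith) hW
    (K := (C : ℝ≥0∞) ^ (1 / q.conjExponent) * X ^ (1 / q)) fun φ hφ => ?_).trans (le_of_eq ?_)
  · set Φ : ℝ → Pos d → ℝ≥0∞ := fun t x => ∫⁻ v, φ (x - t • v, v) with hΦ
    have hΦm : Measurable (Function.uncurry Φ) := by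
      have : Measurable fun y : (ℝ × Pos d) × Pos d => φ (y.1.2 - y.1.1 • y.2, y.2) := by fun_prop
      exact this.lintegral_prod_right'
    have hΦt : ∀ t, Measurable (Φ t) := fun t => hΦm.comp measurable_prodMk_left
    have hpair : ∫⁻ z, (∫⁻ t, G (t, z.1 + t • z.2)) * φ z = ∫⁻ t, ∫⁻ x, G (t, x) * Φ t x := by
      have e1 : ∀ z : Pos d × Pos d, (∫⁻ t, G (t, z.1 + t • z.2)) * φ z =
          ∫⁻ t, G (t, z.1 + t • z.2) * φ z := fun z => by
        rw [lintegral_mul_const _ (by fun_prop)]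
      simp only [e1]
      rw [lintegral_lintegral_swap (Measurable.aemeasurable (by fun_prop))]
      refine lintegral_congr fun t => ?_
      have hm : Measurable fun z : Pos d × Pos d => G (t, z.1) * φ (z.1 - t • z.2, z.2) := by
        fun_prop
      have := (measurePreserving_shear (d := d) t).lintegral_comp hm
      simp only [add_sub_cancel_right] at this
      rw [this, Measure.volume_eq_prod, lintegral_prod _ hm.aemeasurable]
      refine lintegral_congr fun x => ?_
      simp only
      rw [lintegral_const_mul _ (by fun_prop)]
    rw [hpair]
    have hC' : ∫⁻ t, (∫⁻ x, Φ t x ^ (b / (b - 2))) ^ (q.conjExponent / (b / (b - 2))) ≤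
        C * (∫⁻ z, φ z ^ (b / (b - 1))) ^ (q.conjExponent / (b / (b - 1))) := by
      simpa [mixedLintegral, hΦ] using hC φ hφ
    calc _ ≤ ∫⁻ t, (∫⁻ x, G (t, x) ^ (b / 2)) ^ (1 / (b / 2)) *
          (∫⁻ x, Φ t x ^ (b / (b - 2))) ^ (1 / (b / (b - 2))) :=
          lintegral_mono fun t => ENNReal.lintegral_mul_le_Lp_mul_Lq volume hconjP
            (f := fun x => G (t, x)) (Measurable.aemeasurable (by fun_prop)) (hΦt t).aemeasurable
      _ ≤ X ^ (1 / q) * (∫⁻ t, (∫⁻ x, Φ t x ^ (b / (b - 2))) ^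
            (q.conjExponent / (b / (b - 2)))) ^ (1 / q.conjExponent) := by
          refine (ENNReal.lintegral_mul_le_Lp_mul_Lq volume hconj
            (f := fun t => (∫⁻ x, G (t, x) ^ (b / 2)) ^ (1 / (b / 2)))
            (g := fun t => (∫⁻ x, Φ t x ^ (b / (b - 2))) ^ (1 / (b / (b - 2))))
            (Measurable.aemeasurable (by fun_prop))
            (((hΦm.pow_const _).lintegral_prod_right').pow_const _).aemeasurable).trans
            (le_of_eq ?_)
          simp only [← ENNReal.rpow_mul, one_div_mul_eq_div, hX]
      _ ≤ X ^ (1 / q) * (C * (∫⁻ z, φ z ^ (b / (b - 1))) ^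
            (q.conjExponent / (b / (b - 1)))) ^ (1 / q.conjExponent) := by gcongr
      _ = _ := by
          rw [ENNReal.mul_rpow_of_nonneg _ _ (by positivity), ← ENNReal.rpow_mul,
            show q.conjExponent / (b / (b - 1)) * (1 / q.conjExponent) = 1 - 1 / b by
              field_simp]
          ring
  · rw [ENNReal.mul_rpow_of_nonneg _ _ hb0.le, ← ENNReal.rpow_mul X,
      ← ENNReal.coe_rpow_of_nonneg _ (by positivity), ← ENNReal.coe_rpow_of_nonneg _ hb0.le]
    congr 2; ring

/-! ### From nonnegative measurable functions to complex functions defined almost everywhere. -/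

/-- Makes `rhoStar` insensitive to changes of `g` on null sets. At fixed `t` the shear preserves
null sets; exchanging the order of `t` and `z` needs a measurable set, hence the measurable null
superset. -/
theorem ae_ae_line {d : ℕ} {Q : ℝ × Pos d → Prop} (hQ : ∀ᵐ y, Q y) :
    ∀ᵐ z : Pos d × Pos d, ∀ᵐ t : ℝ, Q (t, z.1 + t • z.2) := by
  obtain ⟨S, hS, hSm, hS0⟩ := exists_measurable_superset_of_null (ae_iff.1 hQ)
  have h1 : ∀ᵐ y : ℝ × Pos d, y ∉ S := measure_eq_zero_iff_ae_notMem.1 hS0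
  have h2 : ∀ᵐ t : ℝ, ∀ᵐ z : Pos d × Pos d, (t, z.1 + t • z.2) ∉ S := by
    filter_upwards [Measure.ae_ae_of_ae_prod h1] with t ht
    exact (measurePreserving_shear t).quasiMeasurePreserving.ae
      ((Measure.quasiMeasurePreserving_fst (μ := volume) (ν := volume)).ae ht)
  have h3 := (Measure.ae_ae_comm (μ := volume) (ν := volume)
    (p := fun (t : ℝ) (z : Pos d × Pos d) => (t, z.1 + t • z.2) ∉ S)
    ((hSm.preimage (by fun_prop : Measurable fun y : ℝ × Pos d × Pos d =>
      (y.1, y.2.1 + y.1 • y.2.2))).compl)).1 h2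
  filter_upwards [h3] with z hz
  filter_upwards [hz] with t ht
  by_contra hc
  exact ht (hS hc)

theorem normTX_congr {d : ℕ} {q p : ℝ≥0∞} {g g' : ℝ × Pos d → ℂ} (h : g =ᵐ[volume] g') :
    normTX q p g = normTX q p g' := by
  refine eLpNorm_congr_ae ?_
  filter_upwards [Measure.ae_ae_of_ae_prod h] with t ht
  exact eLpNorm_congr_ae ht

theorem normTX_ofReal {d : ℕ} {q p : ℝ} (hq : 0 < q) (hp : 0 < p) (g : ℝ × Pos d → ℂ) :
    normTX (ENNReal.ofReal q) (ENNReal.ofReal p) g =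
      (∫⁻ t, (∫⁻ x, ‖g (t, x)‖ₑ ^ p) ^ (q / p)) ^ (1 / q) := by
  have hq' : ENNReal.ofReal q ≠ 0 := by simpa using hq
  have hp' : ENNReal.ofReal p ≠ 0 := by simpa using hp
  simp only [normTX, eLpNorm_eq_lintegral_rpow_enorm_toReal hq' ENNReal.ofReal_ne_top,
    eLpNorm_eq_lintegral_rpow_enorm_toReal hp' ENNReal.ofReal_ne_top, enorm_eq_self,
    ENNReal.toReal_ofReal hq.le, ENNReal.toReal_ofReal hp.le, ← ENNReal.rpow_mul,
    one_div_mul_eq_div]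

theorem rhoStar_bound {d : ℕ} (hd : 1 ≤ d) {σ q : ℝ} (hσ : 1 < σ)
    (hq : 1 / q + d / ((d + 1) * σ) = 1) :
    ∃ C : ℝ≥0, ∀ g : ℝ × Pos d → ℂ,
      MemTX (ENNReal.ofReal q) (ENNReal.ofReal ((d + 1) * σ / 2)) g →
        (∀ᵐ z : Pos d × Pos d, Integrable (fun t : ℝ => g (t, z.1 + t • z.2)) volume) ∧
        MemLp (rhoStar g) (ENNReal.ofReal (σ * (d + 1))) volume ∧
        eLpNorm (rhoStar g) (ENNReal.ofReal (σ * (d + 1))) volume ≤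
          C * normTX (ENNReal.ofReal q) (ENNReal.ofReal ((d + 1) * σ / 2)) g := by
  have hd0 : (0 : ℝ) < d := by exact_mod_cast hd
  have hb0 : 0 < σ * (d + 1) := by positivity
  have hp0 : 0 < (d + 1) * σ / 2 := by positivity
  have hq0 : 0 < q := by
    rw [← one_div_pos]
    have : d / ((d + 1) * σ) < 1 := by rw [div_lt_one (by positivity)]; nlinarith
    linarith
  obtain ⟨C, hC⟩ := lintegral_rpow_lintegral_line_le hd hσ hq
  refine ⟨C ^ (1 / (σ * (d + 1))), fun g hg => ?_⟩
  obtain ⟨hgm, hgn⟩ := hg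
  set g' := hgm.mk g
  have hg' : StronglyMeasurable g' := hgm.stronglyMeasurable_mk
  have hae := ae_ae_line hgm.ae_eq_mk
  rw [normTX_congr hgm.ae_eq_mk, normTX_ofReal hq0 hp0] at hgn ⊢
  have hCg := hC (fun y => ‖g' y‖ₑ) hg'.measurable.enorm
  set X := ∫⁻ t, (∫⁻ x, ‖g' (t, x)‖ₑ ^ ((d + 1) * σ / 2)) ^ (q / ((d + 1) * σ / 2))
  have hXt : X ≠ ∞ := by
    intro h
    rw [h, ENNReal.top_rpow_of_pos (by positivity)] at hgn
    exact hgn.ne rfl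
  have hWm : Measurable fun z : Pos d × Pos d => ∫⁻ t, ‖g' (t, z.1 + t • z.2)‖ₑ := by
    have := hg'.measurable
    fun_prop
  have hWt : ∫⁻ z : Pos d × Pos d, (∫⁻ t, ‖g' (t, z.1 + t • z.2)‖ₑ) ^ (σ * (d + 1)) ≠ ∞ :=
    ne_top_of_le_ne_top (ENNReal.mul_ne_top ENNReal.coe_ne_top
      (ENNReal.rpow_ne_top_of_nonneg (by positivity) hXt)) hCg
  have hρ : rhoStar g =ᵐ[volume] rhoStar g' := by
    filter_upwards [hae] with z hz
    exact integral_congr_ae hz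
  have hρm : StronglyMeasurable (rhoStar g') := by
    have : StronglyMeasurable fun y : (Pos d × Pos d) × ℝ => g' (y.2, y.1.1 + y.2 • y.1.2) :=
      hg'.comp_measurable (by fun_prop)
    exact this.integral_prod_right'
  have hnorm : eLpNorm (rhoStar g) (ENNReal.ofReal (σ * (d + 1))) volume ≤
      (C ^ (1 / (σ * (d + 1))) : ℝ≥0) * X ^ (1 / q) := by
    rw [eLpNorm_congr_ae hρ, eLpNorm_eq_lintegral_rpow_enorm_toReal (by simpa using hb0)
      ENNReal.ofReal_ne_top, ENNReal.toReal_ofReal hb0.le]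
    calc _ ≤ (∫⁻ z : Pos d × Pos d, (∫⁻ t, ‖g' (t, z.1 + t • z.2)‖ₑ) ^ (σ * (d + 1))) ^
          (1 / (σ * (d + 1))) := by
          gcongr with z
          exact enorm_integral_le_lintegral_enorm _
      _ ≤ (C * X ^ (σ * (d + 1) / q)) ^ (1 / (σ * (d + 1))) := by gcongr
      _ = _ := by
          rw [ENNReal.mul_rpow_of_nonneg _ _ (by positivity), ← ENNReal.rpow_mul,
            ENNReal.coe_rpow_of_nonneg _ (by positivity)]
          congr 2; field_simp
  refine ⟨?_, ⟨⟨_, hρm, hρ⟩, hnorm.trans_lt (ENNReal.mul_lt_top ENNReal.coe_lt_top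
    (ENNReal.rpow_lt_top_of_nonneg (by positivity) hXt))⟩, hnorm⟩
  -- The bound was proved for the integral of the absolute value, so its finiteness also yields
  -- absolute convergence on almost every line.
  filter_upwards [hae, ae_lt_top (by fun_prop) hWt] with z hz hzt
  have hi : Integrable (fun t : ℝ => g' (t, z.1 + t • z.2)) volume := by
    refine ⟨(hg'.comp_measurable (by fun_prop)).aestronglyMeasurable, ?_⟩
    rw [hasFiniteIntegral_iff_enorm]
    by_contra h
    rw [not_lt, top_le_iff] at h
    rw [h, ENNReal.top_rpow_of_pos hb0] at hzt
    exact hzt.ne rfl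
  exact hi.congr (hz.mono fun t ht => ht.symm)

theorem normTXV_transportSolution_congr {d : ℕ} {q p r : ℝ≥0∞} {f f' : Pos d × Pos d → ℂ}
    (h : f =ᵐ[volume] f') :
    normTXV q p r (transportSolution f) = normTXV q p r (transportSolution f') := by
  unfold normTXV
  congr 1
  funext t
  refine eLpNorm_congr_ae ?_
  have := (measurePreserving_shear (d := d) (-t)).quasiMeasurePreserving.ae h
  filter_upwards [Measure.ae_ae_of_ae_prod this] with x hx
  refine eLpNorm_congr_ae ?_
  filter_upwards [hx] with v hv
  simpa [transportSolution, sub_eq_add_neg] using hv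

theorem normTXV_transportSolution_eq {d : ℕ} {q p r : ℝ≥0∞} (hq : q ≠ 0) (hq' : q ≠ ∞) (hp : p ≠ 0)
    (hp' : p ≠ ∞) (hr : r ≠ 0) (hr' : r ≠ ∞) (f : Pos d × Pos d → ℂ) :
    normTXV q p r (transportSolution f) = mixedLintegral q.toReal p.toReal r.toReal
      (fun y => ‖f (y.2.1 - y.1 • y.2.2, y.2.2)‖ₑ) ^ (1 / q.toReal) := by
  simp only [normTXV, mixedLintegral, transportSolution,
    eLpNorm_eq_lintegral_rpow_enorm_toReal hq hq', eLpNorm_eq_lintegral_rpow_enorm_toReal hp hp',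
    eLpNorm_eq_lintegral_rpow_enorm_toReal hr hr', enorm_eq_self, ← ENNReal.rpow_mul,
    one_div_mul_eq_div]

theorem normTXV_transportSolution_top {d : ℕ} {a : ℝ≥0∞} (ha : a ≠ 0) (ha' : a ≠ ∞)
    {f : Pos d × Pos d → ℂ} (hf : Measurable f) :
    normTXV ∞ a a (transportSolution f) ≤ eLpNorm f a volume := by
  have key : ∀ t : ℝ, eLpNorm (fun x : Pos d =>
      eLpNorm (fun v : Pos d => transportSolution f t x v) a volume) a volume =
        eLpNorm f a volume := by
    intro t
    have ha0 := ENNReal.toReal_pos ha ha'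
    simp only [eLpNorm_eq_lintegral_rpow_enorm_toReal ha ha', enorm_eq_self, ← ENNReal.rpow_mul,
      transportSolution, one_div_mul_cancel ha0.ne', ENNReal.rpow_one]
    congr 1
    have hm : Measurable fun z : Pos d × Pos d => ‖f z‖ₑ ^ a.toReal := by fun_prop
    rw [← (measurePreserving_shear (d := d) (-t)).lintegral_comp hm, Measure.volume_eq_prod,
      lintegral_prod _ (Measurable.aemeasurable (by fun_prop))]
    simp [sub_eq_add_neg]
  unfold normTXV
  simp only [key]
  rw [eLpNorm_exponent_top]
  exact eLpNormEssSup_le_of_ae_enorm_bound (Filter.Eventually.of_forall fun t => by simp)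

theorem NonEndpoint.strichartz {d : ℕ} (hd : 1 ≤ d) {q p r a : ℝ≥0∞} (h : NonEndpoint d q p r a) :
    ∃ C : ℝ≥0, ∀ f₀ : Pos d × Pos d → ℂ, MemLp f₀ a volume →
      normTXV q p r (transportSolution f₀) ≤ C * eLpNorm f₀ a volume := by
  obtain ⟨hq, hp, hr, ha, hscal, hmean, haq, hap⟩ := h
  have hd1 : (1 : ℝ) ≤ d := by exact_mod_cast hd
  have hat : a ≠ ∞ := haq.ne_top
  have inv_zero : ∀ {x : ℝ≥0∞}, 0 < x → ((x⁻¹).toReal = 0 ↔ x = ∞) := fun hx => by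
    simp [ENNReal.toReal_eq_zero_iff, hx.ne']
  have ha0 : 0 < (a⁻¹).toReal := ENNReal.toReal_pos (by simpa) (by simpa using ha.ne')
  rcases hap.eq_or_lt with rfl | hap
  -- The edge `p = a` forces `r = a` and `q = ∞`, where the shear conserves the norm at each time.
  · have hra : (r⁻¹).toReal = (a⁻¹).toReal := by linarith
    obtain rfl : r = a := by
      rw [ENNReal.toReal_eq_toReal_iff' (by simpa using hr.ne') (by simpa using ha.ne')] at hra
      exact inv_injective hra
    obtain rfl : q = ∞ := by
      rw [← inv_zero hq]; linarith
    refine ⟨1, fun f₀ hf => ?_⟩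
    have hfm : AEStronglyMeasurable f₀ volume := hf.1
    rw [normTXV_transportSolution_congr hfm.ae_eq_mk, eLpNorm_congr_ae hfm.ae_eq_mk,
      ENNReal.coe_one, one_mul]
    exact normTXV_transportSolution_top ha.ne' hat hfm.stronglyMeasurable_mk.measurable
  have hapi : (p⁻¹).toReal < (a⁻¹).toReal :=
    ENNReal.toReal_strict_mono (by simpa using ha.ne') (ENNReal.inv_lt_inv.2 hap)
  have haqi : (q⁻¹).toReal < (a⁻¹).toReal :=
    ENNReal.toReal_strict_mono (by simpa using ha.ne') (ENNReal.inv_lt_inv.2 haq)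
  have hqt : q ≠ ∞ := by
    rw [ne_eq, ← inv_zero hq]
    intro h0
    rw [h0, mul_zero, eq_comm, mul_eq_zero] at hscal
    rcases hscal with h | h <;> linarith
  have hrt : r ≠ ∞ := by
    rw [ne_eq, ← inv_zero hr]
    intro h0
    linarith
  -- If `p = ∞` then `1/r = 2/a` and `1/q = d/a ≥ 1/a`, against `q > a`. This is where `d ≥ 1`
  -- excludes the endpoint.
  have hpt : p ≠ ∞ := by
    rw [ne_eq, ← inv_zero hp]
    intro h0
    nlinarith
  have haR := ENNReal.toReal_pos ha.ne' hat
  have hqR := ENNReal.toReal_pos hq.ne' hqt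
  have hpR := ENNReal.toReal_pos hp.ne' hpt
  have hrR := ENNReal.toReal_pos hr.ne' hrt
  simp only [ENNReal.toReal_inv] at hscal hmean
  obtain ⟨C, hC⟩ := mixedLintegral_transport_le hd (q := q.toReal) (p := p.toReal) (r := r.toReal)
    (a := a.toReal) hrR haR (by simpa [div_eq_mul_inv] using hscal)
    (by simpa only [one_div] using hmean) ((ENNReal.toReal_lt_toReal hat hqt).2 haq)
    ((ENNReal.toReal_lt_toReal hat hpt).2 hap)
  refine ⟨C ^ (1 / q.toReal), fun f₀ hf => ?_⟩
  have hfm : AEStronglyMeasurable f₀ volume := hf.1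
  rw [normTXV_transportSolution_congr hfm.ae_eq_mk, eLpNorm_congr_ae hfm.ae_eq_mk,
    normTXV_transportSolution_eq hq.ne' hqt hp.ne' hpt hr.ne' hrt,
    eLpNorm_eq_lintegral_rpow_enorm_toReal ha.ne' hat]
  refine (ENNReal.rpow_le_rpow (hC _ hfm.stronglyMeasurable_mk.measurable.enorm)
    (by positivity)).trans (le_of_eq ?_)
  rw [ENNReal.mul_rpow_of_nonneg _ _ (by positivity), ← ENNReal.rpow_mul,
    ENNReal.coe_rpow_of_nonneg _ (by positivity)]
  congr 2; field_simp

theorem mainTheorem2 (d : ℕ) (hd : 1 ≤ d) :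
    (∀ σ q : ℝ, 1 < σ → 1 / q + d / ((d + 1) * σ) = 1 →
      ∃ C : ℝ≥0, ∀ g : ℝ × Pos d → ℂ,
        MemTX (ENNReal.ofReal q) (ENNReal.ofReal ((d + 1) * σ / 2)) g →
          (∀ᵐ z : Pos d × Pos d, Integrable (fun t : ℝ => g (t, z.1 + t • z.2)) volume) ∧
          MemLp (rhoStar g) (ENNReal.ofReal (σ * (d + 1))) volume ∧
          eLpNorm (rhoStar g) (ENNReal.ofReal (σ * (d + 1))) volume ≤
            C * normTX (ENNReal.ofReal q) (ENNReal.ofReal ((d + 1) * σ / 2)) g) ∧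
    (∀ q p r a : ℝ≥0∞, NonEndpoint d q p r a →
      ∃ C : ℝ≥0, ∀ f₀ : Pos d × Pos d → ℂ, MemLp f₀ a volume →
        normTXV q p r (transportSolution f₀) ≤ C * eLpNorm f₀ a volume) :=
  ⟨fun _ _ hσ hq => rhoStar_bound hd hσ hq, fun _ _ _ _ h => h.strichartz hd⟩
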